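/- **Setting.** Let $\Theta$ and $\Xi$ be measurable spaces, $\pi$ a probability measure on $\Theta$ (the posterior distribution), and $(P_\theta)_{\theta\in\Theta}$ a Markov kernel from $\Theta$ to $\Xi$ (the law of the simulation noise $\xi$ given $\theta$). Let $X\subseteq\mathbb R$ be the decision set, $h:\mathbb R\times\Xi\to\mathbb R$ with $h(y,\cdot)$ measurable for every $y\in X$, and $\alpha\in(0,1)$. Derivatives in the decision variable are taken within $X$ (ordinary derivatives at interior points of $X$, one-sided ones at an end point of an interval). Write $d(x,\xi)=\frac{d}{dx}h(x,\xi)$, $H(x;\theta)=\mathbb E_{\xi\sim P_\theta}[h(x,\xi)]$, and, with $\theta\sim\pi$, $$v_\alpha(x)=\inf\{t:\mathbb P(H(x;\theta)\le t)\ge\alpha\},\qquad c_\alpha(x)=\mathbb E_\theta\big[H(x;\theta)\mid H(x;\theta)\ge v_\alpha(x)\big].$$ Let $\theta_1,\dots,\theta_n$ be i.i.d. from $\pi$ and, given these, let $\xi_1(\theta_i),\dots,\xi_m(\theta_i)$ be i.i.d. from $P_{\theta_i}$, independently over $i$. Put $\hat H^m(x;\theta_i)=\frac1m\sum_{j=1}^m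 h(x,\xi_j(\theta_i))$ and $\hat D^m(x;\theta_i)=\frac1m\sum_{j=1}^m d(x,\xi_j(\theta_i))$, let $\hat v^{n,m}_\alpha(x)$ be the $\lceil\alpha n\rceil$-th smallest of $\hat H^m(x;\theta_1),\dots,\hat H^m(x;\theta_n)$, and let $$\psi^{n,m}_\alpha(x)=\frac1{n(1-\alpha)}\sum_{i=1}^n\hat D^m(x;\theta_i)\,\mathbf 1_{\{\hat H^m(x;\theta_i)\ge\hat v^{n,m}_\alpha(x)\}} .$$ Finally let $\bar{\mathcal E}^m(x;\theta)=\sqrt m\cdot\frac1m\sum_{j=1}^m\big(h(x,\xi_j(\theta))-H(x;\theta)\big)$. **Assumptions.** 1. For every $x\in X$: $\mathbb E_{P_\theta}[h(x,\xi)^2]<\infty$ for $\pi$-almost every $\theta$, and $\int \mathbb E_{P_\theta}[h(x,\xi)^2]\,\pi(d\theta)<\infty$. For every $m\ge1$ the pair $(H(x;\theta),\bar{\mathcal E}^m(x;\theta))$ has a joint density $p_m(t,e)$ on $\mathbb R^2$ that is twice differentiable in $t$ at all $(t,e)$, and there are nonnegative measurable functions $g_{0,m},g_{1,m},g_{2,m}$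 with $p_m(t,e)\le g_{0,m}(e)$, $|\partial_t p_m(t,e)|\le g_{1,m}(e)$, $|\partial_t^2p_m(t,e)|\le g_{2,m}(e)$ for all $(t,e)$, and $\sup_{m\ge1}\int|e|^r g_{i,m}(e)\,de<\infty$ for $i=0,1,2$ and $0\le r\le4$. 2. There is a measurable $K:\Xi\to\mathbb R$ with $\mathbb E_{\theta}\mathbb E_{P_\theta}|K(\xi)|<\infty$ such that for $\pi$-almost every $\theta$: for all $x_1,x_2\in X$, $|h(x_2,\xi)-h(x_1,\xi)|\le K(\xi)|x_2-x_1|$ $P_\theta$-almost surely; and for all $x\in X$, the derivative $d(x,\xi)$ exists $P_\theta$-almost surely. 3. $\sup_{\theta\in\Theta}\mathbb E_{P_\theta}[d(x,\xi)^2]<\infty$ at the point $x$ considered below, where $d(x,\cdot)$ is measurable (and is given the value $0$ where the derivative does not exist). 4. $v_\alpha$ is differentiable at every point of $X$, and $\mathbb P(H(x;\theta)=v_\alpha(x))=0$ for every $x\in X$. **Proposition.** Let $x\in X$ be an accumulation point of $X$. Under Assumptions 1–4, $c_\alpha$ is differentiable at $x$, each $\psi^{n,m}_\alpha(x)$ is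 integrable, and the bias satisfies $$\mathbb E\big[\psi^{n,m}_\alpha(x)\big]-c_\alpha'(x)\to0\qquad\text{as }n,m\to\infty\text{ jointly.}$$ Moreover, if $(n_t)$ and $(m_t)$ are sequences of sample sizes tending to infinity with $n_t=\Theta(m_t)$, then $$\mathbb E\big[\psi^{n_t,m_t}_\alpha(x)\big]-c_\alpha'(x)=\mathcal O\big(n_t^{-1/2}\big).$$ -/

import Mathlib

open MeasureTheory ProbabilityTheory Filter Topology Asymptotics

namespace NestedCVaR

noncomputable section

variable {Θ Ξ : Type*} [MeasurableSpace Θ] [MeasurableSpace Ξ]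

/-! ### The nested objective and its risk functionals

`π` is the (posterior) distribution of the parameter `θ`, `P θ` is the distribution of the
simulation noise `ξ` under `θ`, and `h x ξ` is the simulation output at the decision `x`. -/

/-- `H(x; θ) = 𝔼_{ξ ∼ P_θ}[h(x, ξ)]`. -/
def meanResponse (P : Kernel Θ Ξ) (h : ℝ → Ξ → ℝ) (x : ℝ) (θ : Θ) : ℝ :=
  ∫ ξ, h x ξ ∂(P θ)

/-- The sample path gradient `d(x, ξ) = d h(x, ξ) / dx`, the derivative being taken within the
decision set `X` (one-sided at an end point of an interval, ordinary at an interior point). -/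
def pathGrad (h : ℝ → Ξ → ℝ) (X : Set ℝ) (x : ℝ) (ξ : Ξ) : ℝ :=
  derivWithin (fun y => h y ξ) X x

/-- `v_α(x) = inf {t : ℙ(H(x; θ) ≤ t) ≥ α}`. -/
def valueAtRisk (π : Measure Θ) (P : Kernel Θ Ξ) (h : ℝ → Ξ → ℝ) (α : ℝ) (x : ℝ) : ℝ :=
  sInf {t : ℝ | α ≤ π.real {θ | meanResponse P h x θ ≤ t}}

/-- `c_α(x) = 𝔼_θ[H(x; θ) ∣ H(x; θ) ≥ v_α(x)]`, the conditional expectation given an event. -/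
def condValueAtRisk (π : Measure Θ) (P : Kernel Θ Ξ) (h : ℝ → Ξ → ℝ) (α : ℝ) (x : ℝ) : ℝ :=
  ∫ θ, meanResponse P h x θ
    ∂(ProbabilityTheory.cond π {θ | valueAtRisk π P h α x ≤ meanResponse P h x θ})

/-! ### Sampling -/

/-- The law of `m` i.i.d. draws `ξ₁, …, ξ_m` from `P θ`, as a kernel in `θ`. -/
def iidKernel (P : Kernel Θ Ξ) [IsMarkovKernel P] (m : ℕ) : Kernel Θ (Fin m → Ξ) where
  toFun θ := Measure.pi fun _ : Fin m => P θ
  measurable' := by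
    refine Measurable.measure_of_isPiSystem_of_isProbabilityMeasure
      generateFrom_pi.symm isPiSystem_pi ?_
    rintro s ⟨t, ht, rfl⟩
    simp only [Measure.pi_pi]
    exact Finset.measurable_prod _ fun i _ =>
      P.measurable_coe (ht i (Set.mem_univ i))

instance (P : Kernel Θ Ξ) [IsMarkovKernel P] (m : ℕ) : IsMarkovKernel (iidKernel P m) :=
  ⟨fun θ => by
    change IsProbabilityMeasure (Measure.pi fun _ : Fin m => P θ)
    infer_instance⟩

/-- The joint law of `(θ, (ξ₁, …, ξ_m))` with `θ ∼ π` and, given `θ`, `ξⱼ` i.i.d. from `P θ`. -/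
def innerLaw (π : Measure Θ) (P : Kernel Θ Ξ) [IsMarkovKernel P] (m : ℕ) :
    Measure (Θ × (Fin m → Ξ)) :=
  π ⊗ₘ iidKernel P m

/-- The law of the whole sample: `n` independent copies of `(θ, (ξ₁, …, ξ_m))`. -/
def sampleLaw (π : Measure Θ) (P : Kernel Θ Ξ) [IsMarkovKernel P] (n m : ℕ) :
    Measure (Fin n → Θ × (Fin m → Ξ)) :=
  Measure.pi fun _ : Fin n => innerLaw π P m

/-- `Ĥ^m(x; θ) = (1/m) ∑ⱼ h(x, ξⱼ)`. -/
def meanEst (h : ℝ → Ξ → ℝ) (x : ℝ) {m : ℕ} (ξ : Fin m → Ξ) : ℝ :=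
  (1 / (m : ℝ)) * ∑ j, h x (ξ j)

/-- `D̂^m(x; θ) = (1/m) ∑ⱼ d(x, ξⱼ)`. -/
def gradEst (h : ℝ → Ξ → ℝ) (X : Set ℝ) (x : ℝ) {m : ℕ} (ξ : Fin m → Ξ) : ℝ :=
  (1 / (m : ℝ)) * ∑ j, pathGrad h X x (ξ j)

/-- The normalized error `√m · (1/m) ∑ⱼ (h(x, ξⱼ) - H(x; θ))`. -/
def normalizedError (P : Kernel Θ Ξ) (h : ℝ → Ξ → ℝ) (x : ℝ) {m : ℕ}
    (s : Θ × (Fin m → Ξ)) : ℝ :=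
  Real.sqrt m * ((1 / (m : ℝ)) * ∑ j, (h x (s.2 j) - meanResponse P h x s.1))

/-- The `k`-th smallest (`1 ≤ k ≤ n`) of the numbers `y 0, …, y (n - 1)`. -/
def orderStat {n : ℕ} (y : Fin n → ℝ) (k : ℕ) : ℝ :=
  if hk : k - 1 < n then y (Tuple.sort y ⟨k - 1, hk⟩) else 0

/-- `v̂^{n,m}_α(x)`, the `⌈α n⌉`-th order statistic of `Ĥ^m(x; θ₁), …, Ĥ^m(x; θ_n)`. -/
def quantileEst (h : ℝ → Ξ → ℝ) (α x : ℝ) {n m : ℕ} (s : Fin n → Θ × (Fin m → Ξ)) : ℝ :=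
  orderStat (fun i => meanEst h x (s i).2) ⌈α * n⌉₊

/-- The nested estimator of the CVaR gradient,
`ψ^{n,m}_α(x) = 1 / (n (1 - α)) ∑ᵢ D̂^m(x; θᵢ) 𝟙(Ĥ^m(x; θᵢ) ≥ v̂^{n,m}_α(x))`. -/
def cvarGradEst (h : ℝ → Ξ → ℝ) (X : Set ℝ) (α x : ℝ) {n m : ℕ}
    (s : Fin n → Θ × (Fin m → Ξ)) : ℝ :=
  1 / (n * (1 - α)) *
    ∑ i, if quantileEst h α x s ≤ meanEst h x (s i).2 then gradEst h X x (s i).2 else 0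

/-- The bias `𝔼[ψ^{n,m}_α(x)] - c'_α(x)`. -/
def cvarBias (π : Measure Θ) (P : Kernel Θ Ξ) [IsMarkovKernel P] (h : ℝ → Ξ → ℝ) (X : Set ℝ)
    (α x : ℝ) (n m : ℕ) : ℝ :=
  (∫ s, cvarGradEst h X α x s ∂(sampleLaw π P n m)) - derivWithin (condValueAtRisk π P h α) X x

/-! ### The assumptions -/

/-- Finite second moments, and existence, smoothness and domination of the joint densities
`p m` of `H(x; θ)` and the normalized error of `m ≥ 1` inner samples. -/
structure DensityAssumption (π : Measure Θ) (P : Kernel Θ Ξ) [IsMarkovKernel P]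
    (h : ℝ → Ξ → ℝ) (X : Set ℝ) : Prop where
  secondMoment_ae : ∀ x ∈ X, ∀ᵐ θ ∂π, (∫⁻ ξ, ENNReal.ofReal (h x ξ ^ 2) ∂(P θ)) < ⊤
  secondMoment : ∀ x ∈ X, (∫⁻ θ, ∫⁻ ξ, ENNReal.ofReal (h x ξ ^ 2) ∂(P θ) ∂π) < ⊤
  density : ∀ x ∈ X, ∃ p : ℕ → ℝ → ℝ → ℝ,
    (∀ m, 1 ≤ m →
      Measurable (fun q : ℝ × ℝ => p m q.1 q.2) ∧
      (∀ t e, 0 ≤ p m t e) ∧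
      (innerLaw π P m).map (fun s => (meanResponse P h x s.1, normalizedError P h x s)) =
        (volume : Measure (ℝ × ℝ)).withDensity (fun q => ENNReal.ofReal (p m q.1 q.2)) ∧
      (∀ t e, DifferentiableAt ℝ (fun u => p m u e) t) ∧
      (∀ t e, DifferentiableAt ℝ (deriv fun u => p m u e) t)) ∧
    ∃ g : Fin 3 → ℕ → ℝ → ℝ,
      (∀ i m, 1 ≤ m → Measurable (g i m) ∧ ∀ e, 0 ≤ g i m e) ∧
      (∀ m, 1 ≤ m → ∀ t e,
        p m t e ≤ g 0 m e ∧
        |deriv (fun u => p m u e) t| ≤ g 1 m e ∧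
        |deriv (deriv fun u => p m u e) t| ≤ g 2 m e) ∧
      ∀ (i : Fin 3) (r : ℝ), 0 ≤ r → r ≤ 4 →
        (⨆ m : {m : ℕ // 1 ≤ m}, ∫⁻ e : ℝ, ENNReal.ofReal (|e| ^ r * g i m e)) < ⊤

/-- The sample paths are Lipschitz on `X` with an integrable random constant `K`, and they are
almost surely differentiable at each point of `X`. -/
def InterchangeAssumption (π : Measure Θ) (P : Kernel Θ Ξ) (h : ℝ → Ξ → ℝ) (X : Set ℝ) :
    Prop :=
  ∃ K : Ξ → ℝ, Measurable K ∧ Integrable (fun q : Θ × Ξ => K q.2) (π ⊗ₘ P) ∧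
    ∀ᵐ θ ∂π,
      (∀ x₁ ∈ X, ∀ x₂ ∈ X, ∀ᵐ ξ ∂(P θ), |h x₂ ξ - h x₁ ξ| ≤ K ξ * |x₂ - x₁|) ∧
      (∀ x ∈ X, ∀ᵐ ξ ∂(P θ), DifferentiableWithinAt ℝ (fun y => h y ξ) X x)

/-- `sup_θ 𝔼_{P_θ}[d(x, ξ)²] < ∞`, at the point `x`. -/
def SupremumAssumption (P : Kernel Θ Ξ) (h : ℝ → Ξ → ℝ) (X : Set ℝ) (x : ℝ) : Prop :=
  (⨆ θ, ∫⁻ ξ, ENNReal.ofReal (pathGrad h X x ξ ^ 2) ∂(P θ)) < ⊤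

/-- `v_α` is differentiable on `X`, and `ℙ(H(x; θ) = v_α(x)) = 0` for every `x ∈ X`. -/
structure VaRAssumption (π : Measure Θ) (P : Kernel Θ Ξ) (h : ℝ → Ξ → ℝ) (X : Set ℝ)
    (α : ℝ) : Prop where
  differentiable : DifferentiableOn ℝ (valueAtRisk π P h α) X
  no_atom : ∀ x ∈ X, π {θ | meanResponse P h x θ = valueAtRisk π P h α x} = 0

end

end NestedCVaR

namespace NestedCVaR

/-! ### Sums of independent copies -/

/-! Write H, D for the conditional means of h and d given θ, and Ĥ, D̂ for their inner sample means.

The Rockafellar–Uryasev form c = v + (1-α)⁻¹ E[(H-v)⁺] is differentiated under the integral. The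
kink H = v has probability zero, and the terms with v' cancel because P(H ≥ v) = 1-α. This leaves c'
= (1-α)⁻¹ E[1{H ≥ v} D] (`hasDerivWithinAt_condValueAtRisk`).

The bias is therefore (n(1-α))⁻¹ times the expectation of ∑ᵢ (1{Ĥᵢ ≥ v̂} D̂ᵢ - 1{Hᵢ ≥ v} Dᵢ).
Replacing D̂ by D costs O(1/√m) per term, by the variance of a mean (`gradEst_deviation`). As D is
bounded, it remains to count the indices at which the two selections differ
(`sum_abs_above_orderStat_sub_le`). The distribution of v̂ is never analysed. The sets {Ĥᵢ ≥ v̂} and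
{Ĥᵢ ≥ v} are nested, so they differ in as many indices as their sizes do, and without ties the first
size is deterministic. The second size is compared with #{Hᵢ ≥ v}, a sum of independent indicators
with mean n(1-α) and fluctuation √n. Ĥ and H lie on different sides of v with probability O(1/√m),
by the dominated density (`exists_bound_above_sub`). Together the bias is at most A(1/√m + 1/√n) for
all n, m ≥ 1. -/

theorem integral_abs_le_sqrt {Ω : Type*} [MeasurableSpace Ω] {μ : Measure Ω}
    [IsProbabilityMeasure μ] {f : Ω → ℝ} (hf : MemLp f 2 μ) :
    ∫ ω, |f ω| ∂μ ≤ √(∫ ω, f ω ^ 2 ∂μ) := by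
  refine Real.le_sqrt_of_sq_le ?_
  have h1 := variance_nonneg (fun ω => |f ω|) μ
  rw [variance_eq_sub (X := fun ω => |f ω|) hf.abs] at h1
  simpa [sq_abs] using h1

/-- The mean absolute deviation of a sum of `m` independent copies grows at most like `√m`. -/
theorem integral_abs_sum_sub_le {Ω : Type*} [MeasurableSpace Ω] {μ : Measure Ω}
    [IsProbabilityMeasure μ] {f : Ω → ℝ} (hf : MemLp f 2 μ) (m : ℕ) :
    ∫ s : Fin m → Ω, |∑ j, (f (s j) - ∫ ω, f ω ∂μ)| ∂(Measure.pi fun _ => μ)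
      ≤ √m * √(∫ ω, f ω ^ 2 ∂μ) := by
  set c := ∫ ω, f ω ∂μ with hc
  have hg : MemLp (fun ω => f ω - c) 2 μ := hf.sub (memLp_const c)
  have hgi : ∀ j : Fin m, MemLp (fun s : Fin m → Ω => f (s j) - c) 2 (Measure.pi fun _ => μ) :=
    fun j => hg.comp_measurePreserving (measurePreserving_eval (fun _ => μ) j)
  have hsum : MemLp (fun s : Fin m → Ω => ∑ j, (f (s j) - c)) 2 (Measure.pi fun _ => μ) :=
    memLp_finsetSum _ fun j _ => hgi j
  refine (integral_abs_le_sqrt hsum).trans ?_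
  rw [← Real.sqrt_mul (Nat.cast_nonneg m)]
  refine Real.sqrt_le_sqrt ?_
  -- Centring turns the second moment of the sum into its variance, which independence makes m times
  -- that of `f`.
  have hmean : ∫ s : Fin m → Ω, ∑ j, (f (s j) - c) ∂(Measure.pi fun _ => μ) = 0 := by
    rw [integral_finsetSum _ fun j _ => (hgi j).integrable (by norm_num)]
    refine Finset.sum_eq_zero fun j _ => ?_
    rw [integral_comp_eval (μ := fun _ : Fin m => μ) (i := j) (f := fun ω => f ω - c) hg.1,
      integral_sub (hf.integrable (by norm_num)) (integrable_const c)]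
    simp [hc]
  have hv := variance_eq_sub hsum
  have hv' := variance_sum_pi (μ := fun _ : Fin m => μ) (X := fun _ ω => f ω - c) fun _ => hg
  have hsame : (∑ i : Fin m, fun s : Fin m → Ω => f (s i) - c)
      = fun s => ∑ j, (f (s j) - c) := by
    ext s; simp
  rw [hsame] at hv'
  rw [hmean, hv'] at hv
  have hle : Var[fun ω => f ω - c; μ] ≤ ∫ ω, f ω ^ 2 ∂μ := by
    rw [variance_sub_const hf.1, variance_eq_sub hf]
    simp only [Pi.pow_apply]
    nlinarith [sq_nonneg (∫ ω, f ω ∂μ)]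
  simp only [Pi.pow_apply, Finset.sum_const, Finset.card_univ, Fintype.card_fin, nsmul_eq_mul]
    at hv
  nlinarith [mul_le_mul_of_nonneg_left hle (Nat.cast_nonneg (α := ℝ) m)]

/-! ### Order statistics -/

/-- Sorting preserves counts, and in a monotone list the entry at zero-based position `k - 1` is at
most `a` exactly when more than `k - 1` entries are. -/
theorem orderStat_le_iff {n : ℕ} (y : Fin n → ℝ) {k : ℕ} (hk₁ : 1 ≤ k) (hk : k ≤ n) (a : ℝ) :
    orderStat y k ≤ a ↔ k ≤ (Finset.univ.filter fun i => y i ≤ a).card := by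
  have hlt : k - 1 < n := by omega
  have hsort := Tuple.lt_card_le_iff_apply_le_of_monotone (j := ⟨k - 1, hlt⟩) (a := a)
    (Tuple.monotone_sort y)
  have hcard : (Finset.univ.filter fun i => (y ∘ Tuple.sort y) i ≤ a).card
      = (Finset.univ.filter fun i => y i ≤ a).card :=
    Finset.card_equiv (Tuple.sort y) (by simp)
  rw [hcard] at hsort
  simp only [orderStat, hlt, dif_pos]
  simp only [Function.comp_apply] at hsort
  rw [← hsort]
  omega

theorem measurable_orderStat {n : ℕ} {k : ℕ} (hk₁ : 1 ≤ k) (hk : k ≤ n) :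
    Measurable fun y : Fin n → ℝ => orderStat y k := by
  refine measurable_of_Iic fun a => ?_
  have : (fun y : Fin n → ℝ => orderStat y k) ⁻¹' Set.Iic a
      = {y | (k : ℝ) ≤ ∑ i, if y i ≤ a then (1 : ℝ) else 0} := by
    ext y
    simp [orderStat_le_iff y hk₁ hk]
  rw [this]
  refine measurableSet_le measurable_const (Finset.measurable_sum _ fun i _ => ?_)
  exact Measurable.ite (measurableSet_le (measurable_pi_apply i) measurable_const)
    measurable_const measurable_const

/-- Without ties, exactly `n - k + 1` values lie at or above the `k`-th smallest one. -/
theorem card_orderStat_le {n : ℕ} {y : Fin n → ℝ} (hy : Function.Injective y) {k : ℕ}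
    (hk₁ : 1 ≤ k) (hk : k ≤ n) :
    (Finset.univ.filter fun i => orderStat y k ≤ y i).card = n - k + 1 := by
  have hlt : k - 1 < n := by omega
  -- Without ties the sorted list is strictly increasing, so the values at or above the `k`-th are
  -- exactly those at positions from `k - 1` on.
  have hmono : StrictMono (y ∘ Tuple.sort y) :=
    (Tuple.monotone_sort y).strictMono_of_injective (hy.comp (Tuple.sort y).injective)
  have hcard : (Finset.univ.filter fun i => orderStat y k ≤ y i).card
      = (Finset.Ici (⟨k - 1, hlt⟩ : Fin n)).card := by
    symm
    refine Finset.card_equiv (Tuple.sort y) fun i => ?_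
    simp only [orderStat, hlt, dif_pos, Finset.mem_Ici, Finset.mem_filter, Finset.mem_univ,
      true_and]
    exact hmono.le_iff_le.symm
  rw [hcard, Fin.card_Ici]
  simp only
  omega

/-! ### Selection indicators and the count of differing selections -/

/-- The indicator of `a ≤ b` as a real number. -/
noncomputable def above (a b : ℝ) : ℝ := if a ≤ b then 1 else 0

theorem abs_above_le_one (a b : ℝ) : |above a b| ≤ 1 := by
  unfold above; split_ifs <;> simp

theorem measurable_above {Ω : Type*} [MeasurableSpace Ω] {f g : Ω → ℝ} (hf : Measurable f)
    (hg : Measurable g) : Measurable fun ω => above (f ω) (g ω) :=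
  Measurable.ite (measurableSet_le hf hg) measurable_const measurable_const

/-- Two upper level sets are nested, so that they differ in as many points as their sizes do. -/
theorem sum_abs_above_sub {n : ℕ} (y : Fin n → ℝ) (a b : ℝ) :
    ∑ i, |above a (y i) - above b (y i)| = |∑ i, above a (y i) - ∑ i, above b (y i)| := by
  have key : ∀ {a b : ℝ}, a ≤ b →
      ∑ i, |above a (y i) - above b (y i)| = |∑ i, above a (y i) - ∑ i, above b (y i)| := by
    intro a b hab
    have h0 : ∀ i, 0 ≤ above a (y i) - above b (y i) := by
      intro i
      unfold above
      split_ifs with h1 h2 h2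
      · simp
      · simp
      · exact absurd (hab.trans h2) h1
      · simp
    rw [← Finset.sum_sub_distrib, abs_of_nonneg (Finset.sum_nonneg fun i _ => h0 i)]
    exact Finset.sum_congr rfl fun i _ => abs_of_nonneg (h0 i)
  rcases le_total a b with hab | hab
  · exact key hab
  · rw [abs_sub_comm, ← key hab]
    exact Finset.sum_congr rfl fun i _ => abs_sub_comm _ _

/-- Selecting by the empirical quantile differs from selecting by the true quantile of `z` in a
number of places controlled by the fluctuation of the count for `z`. -/
theorem sum_abs_above_orderStat_sub_le {n : ℕ} (hn : 1 ≤ n) {y : Fin n → ℝ}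
    (hy : Function.Injective y) (z : Fin n → ℝ) {α : ℝ} (hα₀ : 0 < α) (hα₁ : α < 1) (v : ℝ) :
    ∑ i, |above (orderStat y ⌈α * n⌉₊) (y i) - above v (z i)| ≤
      2 * ∑ i, |above v (y i) - above v (z i)| + 1 + |∑ i, (above v (z i) - (1 - α))| := by
  have hn' : (1 : ℝ) ≤ n := by exact_mod_cast hn
  set k := ⌈α * n⌉₊ with hk
  have hk₁ : 1 ≤ k := Nat.one_le_ceil_iff.2 (by positivity)
  have hkn : k ≤ n := Nat.ceil_le.2 (by nlinarith)
  have hkl : α * n ≤ k := Nat.le_ceil _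
  have hku : (k : ℝ) < α * n + 1 := Nat.ceil_lt_add_one (by positivity)
  have hcount : ∑ i, above (orderStat y k) (y i) = n - k + 1 := by
    have := card_orderStat_le hy hk₁ hkn
    simp only [above, Finset.sum_boole, this]
    push_cast [Nat.cast_sub hkn]
    ring
  have h1 : ∑ i, |above (orderStat y k) (y i) - above v (z i)| ≤
      ∑ i, |above (orderStat y k) (y i) - above v (y i)| + ∑ i, |above v (y i) - above v (z i)| := by
    rw [← Finset.sum_add_distrib]
    exact Finset.sum_le_sum fun i _ => abs_sub_le _ _ _
  -- Nestedness replaces the sum of differences by the difference of two counts, one of them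
  -- deterministic.
  rw [sum_abs_above_sub, hcount] at h1
  have h2 : |∑ i, above v (y i) - ∑ i, above v (z i)| ≤ ∑ i, |above v (y i) - above v (z i)| := by
    rw [← Finset.sum_sub_distrib]
    exact Finset.abs_sum_le_sum_abs _ _
  have h3 : ∑ i, (above v (z i) - (1 - α)) = ∑ i, above v (z i) - n * (1 - α) := by
    simp only [Finset.sum_sub_distrib, Finset.sum_const, Finset.card_univ, Fintype.card_fin,
      nsmul_eq_mul]
    ring
  rw [h3]
  -- The additive 1 is the rounding error, since 0 ≤ 1 + αn - k ≤ 1. The `y`–`z` discrepancy enters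
  -- here a second time, whence the factor 2.
  have h4 : |(n : ℝ) - k + 1 - ∑ i, above v (y i)| ≤
      1 + |∑ i, above v (z i) - n * (1 - α)| + |∑ i, above v (y i) - ∑ i, above v (z i)| := by
    have e : (n : ℝ) - k + 1 - ∑ i, above v (y i) = (1 + α * n - k)
        - (∑ i, above v (z i) - n * (1 - α)) - (∑ i, above v (y i) - ∑ i, above v (z i)) := by ring
    rw [e]
    refine (abs_sub _ _).trans (add_le_add_left ((abs_sub _ _).trans (add_le_add_left ?_ _)) _)
    rw [abs_le]; constructor <;> linarith
  linarith

/-- Independent copies of a random variable without atoms have no ties. -/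
theorem ae_injective_of_no_atom {Ω : Type*} [MeasurableSpace Ω] {μ : Measure Ω}
    [IsProbabilityMeasure μ] {Y : Ω → ℝ} (hY : Measurable Y) (hatom : ∀ c, μ {ω | Y ω = c} = 0)
    (n : ℕ) :
    ∀ᵐ s : Fin n → Ω ∂(Measure.pi fun _ => μ), Function.Injective fun i => Y (s i) := by
  have hpair : ∀ i j : Fin n, i ≠ j →
      ∀ᵐ s : Fin n → Ω ∂(Measure.pi fun _ => μ), Y (s i) ≠ Y (s j) := by
    intro i j hij
    have hYi : ∀ l : Fin n, Measurable fun s : Fin n → Ω => Y (s l) :=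
      fun l => hY.comp (measurable_pi_apply l)
    have hind := (iIndepFun_pi (μ := fun _ : Fin n => μ) (X := fun _ => Y)
      fun _ => hY.aemeasurable).indepFun hij
    rw [indepFun_iff_map_prod_eq_prod_map_map (hYi i).aemeasurable (hYi j).aemeasurable] at hind
    have hdiag : MeasurableSet {q : ℝ × ℝ | q.1 = q.2} :=
      measurableSet_eq_fun measurable_fst measurable_snd
    have hmap : (Measure.pi fun _ : Fin n => μ).map (fun s => Y (s j)) = μ.map Y := by
      have := Measure.map_map hY (measurable_pi_apply j) (μ := Measure.pi fun _ : Fin n => μ)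
      rw [(measurePreserving_eval (fun _ : Fin n => μ) j).map_eq] at this
      exact this.symm
    have hz := Measure.map_apply ((hYi i).prodMk (hYi j)) hdiag (μ := Measure.pi fun _ => μ)
    rw [hind, hmap] at hz
    have : ((Measure.pi fun _ : Fin n => μ).map (fun s => Y (s i))).prod (μ.map Y)
        {q : ℝ × ℝ | q.1 = q.2} = 0 := by
      have : IsProbabilityMeasure (μ.map Y) := Measure.isProbabilityMeasure_map hY.aemeasurable
      rw [Measure.measure_prod_null hdiag]
      -- By Fubini each slice of the diagonal is a level set of `Y`, hence null.
      refine Eventually.of_forall fun t => ?_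
      have hm : MeasurableSet (Prod.mk t ⁻¹' {q : ℝ × ℝ | q.1 = q.2}) :=
        measurable_prodMk_left hdiag
      change μ.map Y _ = 0
      rw [Measure.map_apply hY hm]
      rw [← hatom t]
      congr 1
      ext ω
      simp [eq_comm]
    rw [this] at hz
    exact measure_eq_zero_iff_ae_notMem.1 hz.symm
  have hall : ∀ᵐ s : Fin n → Ω ∂(Measure.pi fun _ => μ), ∀ i j : Fin n, i ≠ j → Y (s i) ≠ Y (s j) := by
    simp only [ae_all_iff]
    exact hpair
  filter_upwards [hall] with s hs i j hij
  by_contra hne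
  exact hs i j hne hij

/-! ### Differentiation under the integral sign within a set -/

/-- Dominated convergence for the difference quotients. The exceptional null set in `hlip` may
depend on `y`, as the Lipschitz bound on the sample paths is almost sure only for each pair of
points. -/
theorem hasDerivWithinAt_integral_of_lip {Ω : Type*} [MeasurableSpace Ω] {μ : Measure Ω}
    {F : ℝ → Ω → ℝ} {F' bound : Ω → ℝ} {X : Set ℝ} {x : ℝ} (hx : x ∈ X)
    (hF : ∀ y ∈ X, Integrable (F y) μ) (hbound : Integrable bound μ)
    (hlip : ∀ᶠ y in 𝓝[X] x, ∀ᵐ ω ∂μ, |F y ω - F x ω| ≤ bound ω * |y - x|)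
    (hderiv : ∀ᵐ ω ∂μ, HasDerivWithinAt (fun y => F y ω) (F' ω) X x) :
    HasDerivWithinAt (fun y => ∫ ω, F y ω ∂μ) (∫ ω, F' ω ∂μ) X x := by
  rw [hasDerivWithinAt_iff_tendsto_slope]
  have hsub : 𝓝[X \ {x}] x ≤ 𝓝[X] x := nhdsWithin_mono _ Set.sdiff_subset
  have hlim : Tendsto (fun y => ∫ ω, slope (fun y => F y ω) x y ∂μ) (𝓝[X \ {x}] x)
      (𝓝 (∫ ω, F' ω ∂μ)) := by
    refine tendsto_integral_filter_of_dominated_convergence bound ?_ ?_ hbound ?_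
    · filter_upwards [self_mem_nhdsWithin] with y hy
      simp only [slope_def_field]
      exact (((hF y hy.1).sub (hF x hx)).div_const _).1
    · filter_upwards [self_mem_nhdsWithin, hsub hlip] with y hy hl
      filter_upwards [hl] with ω hω
      have : 0 < |y - x| := abs_pos.2 (sub_ne_zero.2 hy.2)
      rw [slope_def_field, Real.norm_eq_abs, abs_div, div_le_iff₀ this]
      exact hω
    · filter_upwards [hderiv] with ω hω
      exact hasDerivWithinAt_iff_tendsto_slope.1 hω
  refine hlim.congr' ?_
  filter_upwards [self_mem_nhdsWithin] with y hy
  simp only [slope_def_field]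
  rw [integral_div, integral_sub (hF y hy.1) (hF x hx)]

/-! ### The derivative of the conditional value at risk -/

theorem memLp_two_of_lintegral_sq_lt_top {Ω : Type*} [MeasurableSpace Ω] {μ : Measure Ω}
    {f : Ω → ℝ} (hf : Measurable f) (h : (∫⁻ ω, ENNReal.ofReal (f ω ^ 2) ∂μ) < ⊤) :
    MemLp f 2 μ := by
  rw [memLp_two_iff_integrable_sq hf.aestronglyMeasurable]
  exact ⟨(hf.pow_const 2).aestronglyMeasurable,
    (hasFiniteIntegral_iff_ofReal (Eventually.of_forall fun ω => sq_nonneg _)).2 h⟩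

theorem measurable_meanResponse {Θ Ξ : Type*} [MeasurableSpace Θ] [MeasurableSpace Ξ]
    (P : Kernel Θ Ξ) {h : ℝ → Ξ → ℝ} {y : ℝ} (hy : Measurable (h y)) :
    Measurable (meanResponse P h y) :=
  (hy.stronglyMeasurable.integral_kernel (κ := P)).measurable

/-- At a continuity point of the distribution, the quantile is exceeded with probability
exactly `1 - α`. -/
theorem measureReal_sInf_le {Ω : Type*} [MeasurableSpace Ω] {μ : Measure Ω}
    [IsProbabilityMeasure μ] {Y : Ω → ℝ} (hY : Measurable Y) {α : ℝ} (hα₀ : 0 < α) (hα₁ : α < 1)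
    {v : ℝ} (hv : v = sInf {t : ℝ | α ≤ μ.real {ω | Y ω ≤ t}}) (hatom : μ {ω | Y ω = v} = 0) :
    μ.real {ω | v ≤ Y ω} = 1 - α := by
  have : IsProbabilityMeasure (μ.map Y) := Measure.isProbabilityMeasure_map hY.aemeasurable
  set F := cdf (μ.map Y) with hF
  have hFt : ∀ t, F t = μ.real {ω | Y ω ≤ t} := fun t => by
    rw [hF, cdf_eq_real, map_measureReal_apply hY measurableSet_Iic]; rfl
  simp_rw [← hFt] at hv
  have hne : {t : ℝ | α ≤ F t}.Nonempty :=
    (((tendsto_cdf_atTop (μ.map Y)).eventually_const_le hα₁).exists)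
  obtain ⟨b, hb⟩ := ((tendsto_cdf_atBot (μ.map Y)).eventually_lt_const hα₀).exists
  have hbdd : BddBelow {t : ℝ | α ≤ F t} := ⟨b, fun t ht => by
    by_contra hlt
    exact absurd (ht.trans (F.mono (not_le.1 hlt).le)) (not_le.2 hb)⟩
  -- Every point to the right of the infimum exceeds a member of the set; right continuity passes
  -- this to `v`.
  have hge : α ≤ F v := by
    have hc : Tendsto F (𝓝[>] v) (𝓝 (F v)) :=
      (F.right_continuous v).mono_left (nhdsWithin_mono _ Set.Ioi_subset_Ici_self)
    refine ge_of_tendsto hc ?_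
    filter_upwards [self_mem_nhdsWithin] with t ht
    obtain ⟨s, hs, hst⟩ := exists_lt_of_csInf_lt hne (hv ▸ ht)
    exact le_trans hs (F.mono hst.le)
  -- Points to the left lie outside the set, which bounds the left limit by α; without an atom there
  -- is no jump at `v`.
  have hle : F v ≤ α := by
    have hs : (μ.map Y) {v} = 0 := by
      rw [Measure.map_apply hY (measurableSet_singleton v)]
      exact hatom
    rw [← measure_cdf (μ.map Y), StieltjesFunction.measure_singleton, ENNReal.ofReal_eq_zero] at hs
    have hl : Function.leftLim F v ≤ α := by
      refine le_of_tendsto (F.mono.tendsto_leftLim v) ?_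
      filter_upwards [self_mem_nhdsWithin] with t ht
      by_contra hlt
      have := csInf_le hbdd (show α ≤ F t from (not_le.1 hlt).le)
      rw [← hv] at this
      exact absurd ht (not_lt.2 this)
    linarith
  have hlt : μ.real {ω | Y ω < v} = α := by
    rw [← le_antisymm hle hge, hFt]
    refine measureReal_congr ?_
    have : ∀ᵐ ω ∂μ, Y ω ≠ v := measure_eq_zero_iff_ae_notMem.1 hatom
    filter_upwards [this] with ω hω
    exact propext ⟨le_of_lt, fun h => lt_of_le_of_ne h hω⟩
  have hc := probReal_compl_eq_one_sub (μ := μ) (measurableSet_lt hY (measurable_const (a := v)))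
  rw [hlt] at hc
  rw [← hc]
  congr 1
  ext ω
  simp

theorem integral_above_sInf {Ω : Type*} [MeasurableSpace Ω] {μ : Measure Ω}
    [IsProbabilityMeasure μ] {Y : Ω → ℝ} (hY : Measurable Y) {α : ℝ} (hα₀ : 0 < α) (hα₁ : α < 1)
    {v : ℝ} (hv : v = sInf {t : ℝ | α ≤ μ.real {ω | Y ω ≤ t}}) (hatom : μ {ω | Y ω = v} = 0) :
    ∫ ω, above v (Y ω) ∂μ = 1 - α := by
  rw [← measureReal_sInf_le hY hα₀ hα₁ hv hatom,
    ← integral_indicator_one (measurableSet_le measurable_const hY)]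
  refine integral_congr_ae (Eventually.of_forall fun ω => ?_)
  simp [above, Set.indicator_apply]

section

variable {Θ Ξ : Type*} [MeasurableSpace Θ] [MeasurableSpace Ξ]
  {π : Measure Θ} [IsProbabilityMeasure π] {P : Kernel Θ Ξ}
  {h : ℝ → Ξ → ℝ} {X : Set ℝ} {α : ℝ} {x : ℝ}

theorem integrable_meanResponse [IsMarkovKernel P] {y : ℝ} (hy : Measurable (h y))
    (hfin : (∫⁻ θ, ∫⁻ ξ, ENNReal.ofReal (h y ξ ^ 2) ∂(P θ) ∂π) < ⊤) :
    Integrable (meanResponse P h y) π := by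
  have hm : Measurable fun q : Θ × Ξ => h y q.2 := hy.comp measurable_snd
  have h2 : MemLp (fun q : Θ × Ξ => h y q.2) 2 (π ⊗ₘ P) := by
    refine memLp_two_of_lintegral_sq_lt_top hm ?_
    rwa [Measure.lintegral_compProd (hm.pow_const 2).ennreal_ofReal]
  have h1 := (Measure.integrable_compProd_iff hm.aestronglyMeasurable).1 (h2.integrable (by norm_num))
  exact h1.2.mono' (measurable_meanResponse P hy).aestronglyMeasurable
    (Eventually.of_forall fun θ => norm_integral_le_integral_norm _)

/-- The expectation above the quantile, in the form of Rockafellar and Uryasev. -/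
theorem condValueAtRisk_eq (hα₀ : 0 < α) (hα₁ : α < 1) {y : ℝ} (hy : Measurable (h y))
    (hi : Integrable (meanResponse P h y) π)
    (hatom : π {θ | meanResponse P h y θ = valueAtRisk π P h α y} = 0) :
    condValueAtRisk π P h α y = valueAtRisk π P h α y +
      (1 - α)⁻¹ * ∫ θ, max (meanResponse P h y θ - valueAtRisk π P h α y) 0 ∂π := by
  have hH := measurable_meanResponse P hy
  have hS := measureReal_sInf_le hH hα₀ hα₁ (v := valueAtRisk π P h α y) rfl hatom
  set v := valueAtRisk π P h α y with hv
  set S := {θ | v ≤ meanResponse P h y θ} with hSdef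
  have hSm : MeasurableSet S := measurableSet_le measurable_const hH
  have hmax : ∫ θ, max (meanResponse P h y θ - v) 0 ∂π
      = ∫ θ in S, meanResponse P h y θ ∂π - (1 - α) * v := by
    have e : (fun θ => max (meanResponse P h y θ - v) 0)
        = S.indicator fun θ => meanResponse P h y θ - v := by
      ext θ
      by_cases hθ : v ≤ meanResponse P h y θ
      · rw [Set.indicator_of_mem (show θ ∈ S from hθ), max_eq_left (sub_nonneg.2 hθ)]
      · rw [Set.indicator_of_notMem (show θ ∉ S from hθ),
          max_eq_right (sub_nonpos.2 (not_le.1 hθ).le)]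
    rw [e, integral_indicator hSm, integral_sub hi.integrableOn (integrable_const v)]
    simp [hS]
  rw [hmax, condValueAtRisk, ProbabilityTheory.cond, integral_smul_measure, ENNReal.toReal_inv]
  change (π.real S)⁻¹ • _ = _
  rw [hS, smul_eq_mul]
  have : (1 - α) ≠ 0 := by linarith
  field_simp
  ring

/-- One null set of θ must serve all `y ∈ X`. Square integrability is therefore taken at `x` only,
and the bound by `K` carries integrability to every other `y`. -/
theorem ae_interchange [IsMarkovKernel P] {K : Ξ → ℝ} (hK : Measurable K) (hx : x ∈ X)
    (hmeas : ∀ y ∈ X, Measurable (h y))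
    (hsq : ∀ᵐ θ ∂π, (∫⁻ ξ, ENNReal.ofReal (h x ξ ^ 2) ∂(P θ)) < ⊤)
    (hKi : Integrable (fun q : Θ × Ξ => K q.2) (π ⊗ₘ P))
    (hint : ∀ᵐ θ ∂π,
      (∀ x₁ ∈ X, ∀ x₂ ∈ X, ∀ᵐ ξ ∂(P θ), |h x₂ ξ - h x₁ ξ| ≤ K ξ * |x₂ - x₁|) ∧
      (∀ x ∈ X, ∀ᵐ ξ ∂(P θ), DifferentiableWithinAt ℝ (fun y => h y ξ) X x)) :
    ∀ᵐ θ ∂π, (∀ y ∈ X, |meanResponse P h y θ - meanResponse P h x θ|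
        ≤ (∫ ξ, |K ξ| ∂(P θ)) * |y - x|) ∧
      HasDerivWithinAt (fun y => meanResponse P h y θ) (∫ ξ, pathGrad h X x ξ ∂(P θ)) X x := by
  have hKae := ((Measure.integrable_compProd_iff
    (hK.comp measurable_snd).aestronglyMeasurable).1 hKi).1
  filter_upwards [hsq, hKae, hint] with θ h2 hKθ ⟨hlip, hdiff⟩
  have hix : Integrable (h x) (P θ) :=
    (memLp_two_of_lintegral_sq_lt_top (hmeas x hx) h2).integrable (by norm_num)
  have hl : ∀ y ∈ X, ∀ᵐ ξ ∂(P θ), |h y ξ - h x ξ| ≤ |K ξ| * |y - x| := fun y hy => by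
    filter_upwards [hlip x hx y hy] with ξ hξ
    exact hξ.trans (mul_le_mul_of_nonneg_right (le_abs_self _) (abs_nonneg _))
  have hsub : ∀ y ∈ X, Integrable (fun ξ => h y ξ - h x ξ) (P θ) := fun y hy =>
    (hKθ.abs.mul_const |y - x|).mono' ((hmeas y hy).sub (hmeas x hx)).aestronglyMeasurable
      (hl y hy)
  have hi : ∀ y ∈ X, Integrable (h y) (P θ) := fun y hy => by
    have := (hsub y hy).add hix
    refine this.congr (Eventually.of_forall fun ξ => ?_)
    simp
  refine ⟨fun y hy => ?_, ?_⟩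
  · rw [meanResponse, meanResponse, ← integral_sub (hi y hy) hix, ← integral_mul_const]
    exact (abs_integral_le_integral_abs).trans
      (integral_mono_ae (hsub y hy).abs (hKθ.abs.mul_const _) (hl y hy))
  · refine hasDerivWithinAt_integral_of_lip hx hi hKθ.abs ?_ ?_
    · filter_upwards [self_mem_nhdsWithin] with y hy using hl y hy
    · filter_upwards [hdiff x hx] with ξ hξ using hξ.hasDerivWithinAt

/-- Away from the kink the positive part coincides near `x` with 0 or with `f - g`. -/
theorem hasDerivWithinAt_max_sub {f g : ℝ → ℝ} {f' g' : ℝ} (hf : HasDerivWithinAt f f' X x)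
    (hg : HasDerivWithinAt g g' X x) (hne : f x ≠ g x) :
    HasDerivWithinAt (fun y => max (f y - g y) 0) (above (g x) (f x) * (f' - g')) X x := by
  have hc : ContinuousWithinAt (fun y => f y - g y) X x := (hf.sub hg).continuousWithinAt
  rcases lt_or_gt_of_ne hne with hlt | hgt
  · have : above (g x) (f x) * (f' - g') = 0 := by simp [above, hlt]
    rw [this]
    refine (hasDerivWithinAt_const x X (0 : ℝ)).congr_of_eventuallyEq ?_
      (max_eq_right (sub_nonpos.2 hlt.le))
    filter_upwards [hc.eventually_lt_const (sub_neg.2 hlt)] with y hy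
    exact max_eq_right hy.le
  · have : above (g x) (f x) * (f' - g') = f' - g' := by simp [above, hgt.le]
    rw [this]
    refine (hf.sub hg).congr_of_eventuallyEq ?_ (max_eq_left (sub_nonneg.2 hgt.le))
    filter_upwards [hc.eventually_const_lt (sub_pos.2 hgt)] with y hy
    exact max_eq_left hy.le

theorem exists_bound_pathGrad (hgrad : Measurable (pathGrad h X x))
    (hsup : SupremumAssumption P h X x) :
    ∃ M : ℝ, 0 ≤ M ∧ ∀ θ, MemLp (pathGrad h X x) 2 (P θ) ∧
      √(∫ ξ, pathGrad h X x ξ ^ 2 ∂(P θ)) ≤ M := by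
  have hle : ∀ θ, (∫⁻ ξ, ENNReal.ofReal (pathGrad h X x ξ ^ 2) ∂(P θ))
      ≤ ⨆ θ, ∫⁻ ξ, ENNReal.ofReal (pathGrad h X x ξ ^ 2) ∂(P θ) := fun θ =>
    le_iSup (fun θ => ∫⁻ ξ, ENNReal.ofReal (pathGrad h X x ξ ^ 2) ∂(P θ)) θ
  refine ⟨√(⨆ θ, ∫⁻ ξ, ENNReal.ofReal (pathGrad h X x ξ ^ 2) ∂(P θ)).toReal,
    Real.sqrt_nonneg _, fun θ => ⟨memLp_two_of_lintegral_sq_lt_top hgrad ((hle θ).trans_lt hsup),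
      Real.sqrt_le_sqrt ?_⟩⟩
  rw [integral_eq_lintegral_of_nonneg_ae (Eventually.of_forall fun ξ => sq_nonneg _)
    (hgrad.pow_const 2).aestronglyMeasurable]
  exact ENNReal.toReal_mono hsup.ne (hle θ)

theorem measurable_integral_pathGrad (hgrad : Measurable (pathGrad h X x)) :
    Measurable fun θ => ∫ ξ, pathGrad h X x ξ ∂(P θ) :=
  (hgrad.stronglyMeasurable.integral_kernel (κ := P)).measurable

theorem abs_integral_pathGrad_le [IsMarkovKernel P] {M : ℝ}
    (hM : ∀ θ, MemLp (pathGrad h X x) 2 (P θ) ∧ √(∫ ξ, pathGrad h X x ξ ^ 2 ∂(P θ)) ≤ M) (θ : Θ) :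
    |∫ ξ, pathGrad h X x ξ ∂(P θ)| ≤ M :=
  (abs_integral_le_integral_abs).trans ((integral_abs_le_sqrt (hM θ).1).trans (hM θ).2)

theorem hasDerivWithinAt_condValueAtRisk [IsMarkovKernel P] (hα₀ : 0 < α) (hα₁ : α < 1) (hx : x ∈ X)
    (hmeas : ∀ y ∈ X, Measurable (h y)) (hgrad : Measurable (pathGrad h X x))
    (hdens : DensityAssumption π P h X) (hint : InterchangeAssumption π P h X)
    (hsup : SupremumAssumption P h X x) (hvar : VaRAssumption π P h X α) :
    HasDerivWithinAt (condValueAtRisk π P h α)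
      ((1 - α)⁻¹ * ∫ θ, above (valueAtRisk π P h α x) (meanResponse P h x θ) *
        ∫ ξ, pathGrad h X x ξ ∂(P θ) ∂π) X x := by
  obtain ⟨K, hK, hKi, hKae⟩ := hint
  obtain ⟨M, -, hM⟩ := exists_bound_pathGrad hgrad hsup
  have hae := ae_interchange hK hx hmeas (hdens.secondMoment_ae x hx) hKi hKae
  have hKint := ((Measure.integrable_compProd_iff
    (hK.comp measurable_snd).aestronglyMeasurable).1 hKi).2
  simp only [Real.norm_eq_abs] at hKint
  set v := valueAtRisk π P h α with hv
  set v' := derivWithin v X x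
  set D : Θ → ℝ := fun θ => ∫ ξ, pathGrad h X x ξ ∂(P θ) with hD
  have hvd : HasDerivWithinAt v v' X x := (hvar.differentiable x hx).hasDerivWithinAt
  have hHm := measurable_meanResponse P (hmeas x hx)
  have hHi : ∀ y ∈ X, Integrable (meanResponse P h y) π := fun y hy =>
    integrable_meanResponse (hmeas y hy) (hdens.secondMoment y hy)
  -- Differentiability of `v` at `x` gives |v y - v x| ≤ C|y - x| near `x`, the share of `v` in the
  -- dominating function.
  obtain ⟨C, hC⟩ := hvd.hasFDerivWithinAt.isBigO_sub.bound
  have hmain : HasDerivWithinAt (fun y => ∫ θ, max (meanResponse P h y θ - v y) 0 ∂π)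
      (∫ θ, above (v x) (meanResponse P h x θ) * (D θ - v') ∂π) X x := by
    refine hasDerivWithinAt_integral_of_lip hx
      (bound := fun θ => (∫ ξ, |K ξ| ∂(P θ)) + C)
      (fun y hy => ((hHi y hy).sub (integrable_const (v y))).pos_part)
      (hKint.add (integrable_const C)) ?_ ?_
    · filter_upwards [hC, self_mem_nhdsWithin] with y hy hyX
      filter_upwards [hae] with θ hθ
      have h1 := hθ.1 y hyX
      simp only [Real.norm_eq_abs] at hy
      refine (abs_max_sub_max_le_abs _ _ _).trans ?_
      have e : meanResponse P h y θ - v y - (meanResponse P h x θ - v x)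
        = (meanResponse P h y θ - meanResponse P h x θ) - (v y - v x) := by ring
      rw [e]
      refine (abs_sub _ _).trans ?_
      rw [add_mul]
      exact add_le_add h1 hy
    · have hne : ∀ᵐ θ ∂π, meanResponse P h x θ ≠ v x :=
        measure_eq_zero_iff_ae_notMem.1 (hvar.no_atom x hx)
      filter_upwards [hae, hne] with θ hθ hθn
      exact hasDerivWithinAt_max_sub hθ.2 hvd hθn
  have haI : Integrable (fun θ => above (v x) (meanResponse P h x θ)) π :=
    Integrable.of_bound (measurable_above measurable_const hHm).aestronglyMeasurable 1
      (Eventually.of_forall fun θ => abs_above_le_one _ _)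
  have haDI : Integrable (fun θ => above (v x) (meanResponse P h x θ) * D θ) π := by
    refine haI.mul_bdd (c := M) (measurable_integral_pathGrad hgrad).aestronglyMeasurable
      (Eventually.of_forall fun θ => abs_integral_pathGrad_le hM θ)
  have haint : ∫ θ, above (v x) (meanResponse P h x θ) ∂π = 1 - α :=
    integral_above_sInf hHm hα₀ hα₁ rfl (hvar.no_atom x hx)
  have hval : ∫ θ, above (v x) (meanResponse P h x θ) * (D θ - v') ∂π
      = ∫ θ, above (v x) (meanResponse P h x θ) * D θ ∂π - (1 - α) * v' := by
    simp_rw [mul_sub]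
    rw [integral_sub haDI (haI.mul_const _), integral_mul_const, haint]
  have hc := hvd.add (hmain.const_mul (1 - α)⁻¹)
  -- The two occurrences of `v'` cancel because the selected event has probability 1 - α.
  have heq : v' + (1 - α)⁻¹ * ∫ θ, above (v x) (meanResponse P h x θ) * (D θ - v') ∂π
      = (1 - α)⁻¹ * ∫ θ, above (v x) (meanResponse P h x θ) * D θ ∂π := by
    have : (1 - α) ≠ 0 := by linarith
    rw [hval]
    field_simp
    ring
  rw [heq] at hc
  exact hc.congr (fun y hy => condValueAtRisk_eq hα₀ hα₁ (hmeas y hy) (hHi y hy)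
    (hvar.no_atom y hy)) (condValueAtRisk_eq hα₀ hα₁ (hmeas x hx) (hHi x hx) (hvar.no_atom x hx))

end

/-! ### Consequences of a dominated joint density -/

/-- For fixed e the admissible t form an interval of length 2δ|e|, on which the density is at most
`g e`; integrating over e gives the bound. -/
theorem measure_abs_sub_le_of_density {Ω : Type*} [MeasurableSpace Ω] {μ : Measure Ω}
    {T E : Ω → ℝ} (hT : Measurable T) (hE : Measurable E) {p : ℝ → ℝ → ℝ} {g : ℝ → ℝ}
    (hp : Measurable fun q : ℝ × ℝ => p q.1 q.2)
    (hmap : μ.map (fun ω => (T ω, E ω)) =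
      (volume : Measure (ℝ × ℝ)).withDensity fun q => ENNReal.ofReal (p q.1 q.2))
    (hpg : ∀ t e, p t e ≤ g e) (v : ℝ) {δ : ℝ} (hδ : 0 ≤ δ) :
    μ {ω | |T ω - v| ≤ |E ω| * δ} ≤
      ENNReal.ofReal (2 * δ) * ∫⁻ e, ENNReal.ofReal (|e| * g e) := by
  set B : Set (ℝ × ℝ) := {q | |q.1 - v| ≤ |q.2| * δ} with hB
  have hBm : MeasurableSet B := by
    refine measurableSet_le ?_ ?_ <;> fun_prop
  have h1 : μ {ω | |T ω - v| ≤ |E ω| * δ} = μ.map (fun ω => (T ω, E ω)) B := by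
    rw [Measure.map_apply (hT.prodMk hE) hBm]; rfl
  have hind : Measurable (B.indicator fun q => ENNReal.ofReal (p q.1 q.2)) :=
    hp.ennreal_ofReal.indicator hBm
  rw [h1, hmap, withDensity_apply _ hBm, ← lintegral_indicator hBm, Measure.volume_eq_prod,
    lintegral_prod_symm _ hind.aemeasurable, ← lintegral_const_mul' _ _ ENNReal.ofReal_ne_top]
  refine lintegral_mono fun e => ?_
  calc ∫⁻ t, B.indicator (fun q => ENNReal.ofReal (p q.1 q.2)) (t, e)
      ≤ ∫⁻ t, (Set.Icc (v - |e| * δ) (v + |e| * δ)).indicator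
          (fun _ => ENNReal.ofReal (g e)) t := by
        refine lintegral_mono fun t => ?_
        by_cases ht : (t, e) ∈ B
        · have ht' : t ∈ Set.Icc (v - |e| * δ) (v + |e| * δ) := by
            have := abs_le.1 (show |t - v| ≤ |e| * δ from ht)
            constructor <;> linarith [this.1, this.2]
          rw [Set.indicator_of_mem ht, Set.indicator_of_mem ht']
          exact ENNReal.ofReal_le_ofReal (hpg t e)
        · rw [Set.indicator_of_notMem ht]
          exact zero_le
    _ = ENNReal.ofReal (g e) * ENNReal.ofReal (2 * δ * |e|) := by
        rw [lintegral_indicator_const measurableSet_Icc, Real.volume_Icc]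
        congr 2
        ring
    _ = ENNReal.ofReal (2 * δ) * ENNReal.ofReal (|e| * g e) := by
        rw [ENNReal.ofReal_mul (by positivity), ENNReal.ofReal_mul (abs_nonneg e)]
        ring

/-- The event is a line in the (t, e)-plane meeting each slice of constant t in one point, since `δ
≠ 0`; it is Lebesgue null. -/
theorem measure_add_mul_eq_of_density {Ω : Type*} [MeasurableSpace Ω] {μ : Measure Ω}
    {T E : Ω → ℝ} (hT : Measurable T) (hE : Measurable E) {f : ℝ × ℝ → ENNReal}
    (hmap : μ.map (fun ω => (T ω, E ω)) = (volume : Measure (ℝ × ℝ)).withDensity f)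
    {δ : ℝ} (hδ : δ ≠ 0) (c : ℝ) :
    μ {ω | T ω + E ω * δ = c} = 0 := by
  set B : Set (ℝ × ℝ) := {q | q.1 + q.2 * δ = c} with hB
  have hBm : MeasurableSet B := by
    refine measurableSet_eq_fun ?_ measurable_const
    fun_prop
  have h1 : μ {ω | T ω + E ω * δ = c} = μ.map (fun ω => (T ω, E ω)) B := by
    rw [Measure.map_apply (hT.prodMk hE) hBm]; rfl
  rw [h1, hmap]
  refine withDensity_absolutelyContinuous _ _ ?_
  rw [Measure.volume_eq_prod, Measure.measure_prod_null hBm]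
  refine Eventually.of_forall fun t => ?_
  refine measure_mono_null (t := {(c - t) / δ}) (fun e he => ?_) (measure_singleton _)
  have : t + e * δ = c := he
  rw [Set.mem_singleton_iff, eq_div_iff hδ]
  linarith

/-- If `v` separates `a` from `b`, then `b` is no farther from `v` than from `a`. -/
theorem abs_above_sub_above_le (v a b : ℝ) :
    |above v a - above v b| ≤ Set.indicator {q : ℝ × ℝ | |q.2 - v| ≤ |q.1 - q.2|} 1 (a, b) := by
  by_cases hq : |b - v| ≤ |a - b|
  · rw [Set.indicator_of_mem (show (a, b) ∈ {q : ℝ × ℝ | |q.2 - v| ≤ |q.1 - q.2|} from hq)]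
    unfold above
    split_ifs <;> simp
  · rw [Set.indicator_of_notMem (show (a, b) ∉ {q : ℝ × ℝ | |q.2 - v| ≤ |q.1 - q.2|} from hq)]
    have hq' := not_le.1 hq
    unfold above
    split_ifs with h1 h2 h2
    · simp
    · exfalso
      rw [abs_of_pos (show 0 < a - b by linarith), abs_of_neg (show b - v < 0 by linarith)] at hq'
      linarith
    · exfalso
      rw [abs_of_neg (show a - b < 0 by linarith), abs_of_nonneg (show 0 ≤ b - v by linarith)]
        at hq'
      linarith
    · simp

theorem cvarGradEst_eq {Θ Ξ : Type*} {h : ℝ → Ξ → ℝ} {X : Set ℝ} {α x : ℝ} {n m : ℕ}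
    (s : Fin n → Θ × (Fin m → Ξ)) :
    cvarGradEst h X α x s = 1 / (n * (1 - α)) *
      ∑ i, above (quantileEst h α x s) (meanEst h x (s i).2) * gradEst h X x (s i).2 := by
  simp [cvarGradEst, above]

section

variable {Θ Ξ : Type*} [MeasurableSpace Θ] [MeasurableSpace Ξ]
  {π : Measure Θ} {P : Kernel Θ Ξ}
  {h : ℝ → Ξ → ℝ} {X : Set ℝ} {α : ℝ} {x : ℝ}

instance [IsMarkovKernel P] [IsProbabilityMeasure π] (m : ℕ) : IsProbabilityMeasure (innerLaw π P m) :=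
  inferInstanceAs (IsProbabilityMeasure (π ⊗ₘ iidKernel P m))

instance [IsMarkovKernel P] [IsProbabilityMeasure π] (n m : ℕ) : IsProbabilityMeasure (sampleLaw π P n m) :=
  inferInstanceAs (IsProbabilityMeasure (Measure.pi fun _ : Fin n => innerLaw π P m))

theorem measurable_meanEst (hx : Measurable (h x)) (m : ℕ) :
    Measurable fun s : Θ × (Fin m → Ξ) => meanEst h x s.2 := by
  refine (Finset.measurable_sum _ fun j _ => ?_).const_mul _
  exact hx.comp ((measurable_pi_apply j).comp measurable_snd)

theorem measurable_gradEst (hgrad : Measurable (pathGrad h X x)) (m : ℕ) :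
    Measurable fun s : Θ × (Fin m → Ξ) => gradEst h X x s.2 := by
  refine (Finset.measurable_sum _ fun j _ => ?_).const_mul _
  exact hgrad.comp ((measurable_pi_apply j).comp measurable_snd)

theorem measurable_normalizedError (hx : Measurable (h x)) (m : ℕ) :
    Measurable fun s : Θ × (Fin m → Ξ) => normalizedError P h x s := by
  refine ((Finset.measurable_sum _ fun j _ => ?_).const_mul _).const_mul _
  exact (hx.comp ((measurable_pi_apply j).comp measurable_snd)).sub
    ((measurable_meanResponse P hx).comp measurable_fst)

theorem meanEst_eq {m : ℕ} (hm : 1 ≤ m) (s : Θ × (Fin m → Ξ)) :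
    meanEst h x s.2 = meanResponse P h x s.1 + normalizedError P h x s * (√m)⁻¹ := by
  have hm' : (0 : ℝ) < m := by exact_mod_cast hm
  have hs : √(m : ℝ) ≠ 0 := (Real.sqrt_pos.2 hm').ne'
  simp only [meanEst, normalizedError, Finset.sum_sub_distrib, Finset.sum_const, Finset.card_univ,
    Fintype.card_fin, nsmul_eq_mul]
  field_simp
  ring

/-- The selections differ only if |H - v| ≤ |E|/√m, with E the normalized error. The supremum over m
of the first moments of `g 0 m` makes the constant independent of m. -/
theorem exists_bound_above_sub [IsMarkovKernel P] [IsProbabilityMeasure π] (hx : x ∈ X) (hmeas : Measurable (h x))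
    (hdens : DensityAssumption π P h X) (v : ℝ) :
    ∃ C : ℝ, 0 ≤ C ∧ ∀ m : ℕ, 1 ≤ m →
      ∫ s, |above v (meanEst h x s.2) - above v (meanResponse P h x s.1)| ∂(innerLaw π P m)
        ≤ C * (√m)⁻¹ := by
  obtain ⟨p, hp, g, -, hpg, hfin⟩ := hdens.density x hx
  have hfin1 := hfin 0 1 zero_le_one (by norm_num)
  simp only [Real.rpow_one] at hfin1
  set Λ := ⨆ m : {m : ℕ // 1 ≤ m}, ∫⁻ e : ℝ, ENNReal.ofReal (|e| * g 0 m e) with hΛ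
  refine ⟨2 * Λ.toReal, by positivity, fun m hm => ?_⟩
  obtain ⟨hpm, -, hmap, -⟩ := hp m hm
  have hH : Measurable fun s : Θ × (Fin m → Ξ) => meanResponse P h x s.1 :=
    (measurable_meanResponse P hmeas).comp measurable_fst
  have hE := measurable_normalizedError (Θ := Θ) (P := P) hmeas m
  have hle := measure_abs_sub_le_of_density hH hE hpm hmap (fun t e => (hpg m hm t e).1) v
    (inv_nonneg.2 (Real.sqrt_nonneg (m : ℝ)))
  set B : Set (Θ × (Fin m → Ξ)) :=
    {s | |meanResponse P h x s.1 - v| ≤ |normalizedError P h x s| * (√m)⁻¹} with hB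
  have hBm : MeasurableSet B :=
    measurableSet_le (hH.sub_const v).abs (hE.abs.mul_const _)
  have hΛle : ∫⁻ e : ℝ, ENNReal.ofReal (|e| * g 0 m e) ≤ Λ :=
    le_iSup (fun m : {m : ℕ // 1 ≤ m} => ∫⁻ e : ℝ, ENNReal.ofReal (|e| * g 0 m e)) ⟨m, hm⟩
  have hpt : ∀ s : Θ × (Fin m → Ξ),
      |above v (meanEst h x s.2) - above v (meanResponse P h x s.1)| ≤ B.indicator 1 s := by
    intro s
    refine (abs_above_sub_above_le _ _ _).trans (le_of_eq ?_)
    simp only [Set.indicator_apply, Set.mem_ofPred_eq, hB, meanEst_eq (P := P) hm,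
      add_sub_cancel_left, abs_mul, abs_inv, abs_of_nonneg (Real.sqrt_nonneg (m : ℝ)), Pi.one_apply]
  calc _ ≤ ∫ s, B.indicator 1 s ∂(innerLaw π P m) :=
        integral_mono_of_nonneg (Eventually.of_forall fun s => abs_nonneg _)
          ((integrable_const (1 : ℝ)).indicator hBm) (Eventually.of_forall hpt)
    _ = (innerLaw π P m).real B := integral_indicator_one hBm
    _ ≤ (ENNReal.ofReal (2 * (√m)⁻¹) * Λ).toReal :=
        ENNReal.toReal_mono (ENNReal.mul_ne_top ENNReal.ofReal_ne_top hfin1.ne)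
          (hle.trans (mul_le_mul_right hΛle _))
    _ = 2 * Λ.toReal * (√m)⁻¹ := by
        rw [ENNReal.toReal_mul, ENNReal.toReal_ofReal (by positivity)]
        ring

/-- Excludes ties among the sample means, which the deterministic count above the order statistic
requires. -/
theorem measure_meanEst_eq [IsMarkovKernel P] (hx : x ∈ X) (hmeas : Measurable (h x))
    (hdens : DensityAssumption π P h X) {m : ℕ} (hm : 1 ≤ m) (c : ℝ) :
    innerLaw π P m {s | meanEst h x s.2 = c} = 0 := by
  obtain ⟨p, hp, -⟩ := hdens.density x hx
  have hm' : (0 : ℝ) < m := by exact_mod_cast hm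
  have := measure_add_mul_eq_of_density ((measurable_meanResponse P hmeas).comp measurable_fst)
    (measurable_normalizedError hmeas m) (hp m hm).2.2.1
    (inv_ne_zero (Real.sqrt_pos.2 hm').ne') c
  simp_rw [meanEst_eq (P := P) hm]
  exact this

/-! ### The inner gradient estimator -/

theorem integrable_innerLaw_fst [IsMarkovKernel P] [IsProbabilityMeasure π] {f : Θ → ℝ} (hf : Integrable f π) (m : ℕ) :
    Integrable (fun s : Θ × (Fin m → Ξ) => f s.1) (innerLaw π P m) := by
  have h1 : (innerLaw π P m).map Prod.fst = π := Measure.fst_compProd π (iidKernel P m)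
  rw [← h1] at hf
  exact hf.comp_measurable measurable_fst

theorem integral_innerLaw_fst [IsMarkovKernel P] [IsProbabilityMeasure π] {f : Θ → ℝ} (hf : Measurable f) (m : ℕ) :
    ∫ s, f s.1 ∂(innerLaw π P m) = ∫ θ, f θ ∂π := by
  have h1 : (innerLaw π P m).map Prod.fst = π := Measure.fst_compProd π (iidKernel P m)
  conv_rhs => rw [← h1]
  exact (integral_map measurable_fst.aemeasurable hf.aestronglyMeasurable).symm

/-- Given θ the inner draws are independent, so the deviation is at most M√m/m; as `M` does not
depend on θ, the bound survives integration over `π`. -/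
theorem gradEst_deviation [IsMarkovKernel P] [IsProbabilityMeasure π] (hgrad : Measurable (pathGrad h X x)) {M : ℝ}
    (hM : ∀ θ, MemLp (pathGrad h X x) 2 (P θ) ∧ √(∫ ξ, pathGrad h X x ξ ^ 2 ∂(P θ)) ≤ M)
    {m : ℕ} (hm : 1 ≤ m) :
    Integrable (fun s => gradEst h X x s.2 - ∫ ξ, pathGrad h X x ξ ∂(P s.1)) (innerLaw π P m) ∧
    ∫ s, |gradEst h X x s.2 - ∫ ξ, pathGrad h X x ξ ∂(P s.1)| ∂(innerLaw π P m) ≤ M * (√m)⁻¹ := by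
  have hm' : (0 : ℝ) < m := by exact_mod_cast hm
  have heq : ∀ θ, ∀ ξ : Fin m → Ξ, gradEst h X x ξ - ∫ ξ, pathGrad h X x ξ ∂(P θ)
      = (m : ℝ)⁻¹ * ∑ j, (pathGrad h X x (ξ j) - ∫ ξ, pathGrad h X x ξ ∂(P θ)) := by
    intro θ ξ
    simp only [gradEst, Finset.sum_sub_distrib, Finset.sum_const, Finset.card_univ,
      Fintype.card_fin, nsmul_eq_mul]
    field_simp
  have hmeas : Measurable fun s : Θ × (Fin m → Ξ) =>
      gradEst h X x s.2 - ∫ ξ, pathGrad h X x ξ ∂(P s.1) :=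
    (measurable_gradEst hgrad m).sub ((measurable_integral_pathGrad hgrad).comp measurable_fst)
  have hin : ∀ θ, Integrable (fun ξ => gradEst h X x ξ - ∫ ξ, pathGrad h X x ξ ∂(P θ))
      (iidKernel P m θ) := by
    intro θ
    change Integrable _ (Measure.pi fun _ => P θ)
    simp_rw [heq]
    refine (integrable_finsetSum _ fun j _ => ?_).const_mul _
    exact (integrable_comp_eval (μ := fun _ : Fin m => P θ) (i := j)
      ((hM θ).1.integrable (by norm_num))).sub (integrable_const _)
  have hbd : ∀ θ, ∫ ξ, |gradEst h X x ξ - ∫ ξ, pathGrad h X x ξ ∂(P θ)| ∂(iidKernel P m θ)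
      ≤ M * (√m)⁻¹ := by
    intro θ
    change ∫ ξ, _ ∂(Measure.pi fun _ => P θ) ≤ _
    simp_rw [heq, abs_mul, abs_inv, Nat.abs_cast]
    rw [integral_const_mul]
    have h1 := (integral_abs_sum_sub_le (hM θ).1 m).trans
      (mul_le_mul_of_nonneg_left (hM θ).2 (Real.sqrt_nonneg _))
    refine (mul_le_mul_of_nonneg_left h1 (inv_nonneg.2 hm'.le)).trans (le_of_eq ?_)
    rw [← mul_assoc, inv_mul_eq_div, Real.sqrt_div_self', one_div, mul_comm]
  have houter : Integrable (fun θ => ∫ ξ, |gradEst h X x ξ - ∫ ξ, pathGrad h X x ξ ∂(P θ)|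
      ∂(iidKernel P m θ)) π := by
    refine Integrable.of_bound ?_ (M * (√m)⁻¹) (Eventually.of_forall fun θ => ?_)
    · exact (hmeas.abs.stronglyMeasurable.integral_kernel_prod_right'
        (κ := iidKernel P m)).aestronglyMeasurable
    · rw [Real.norm_eq_abs, abs_of_nonneg (integral_nonneg fun _ => abs_nonneg _)]
      exact hbd θ
  have hint : Integrable (fun s => gradEst h X x s.2 - ∫ ξ, pathGrad h X x ξ ∂(P s.1))
      (innerLaw π P m) :=
    (Measure.integrable_compProd_iff hmeas.aestronglyMeasurable).2
      ⟨Eventually.of_forall hin, houter⟩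
  refine ⟨hint, ?_⟩
  have h1 := Measure.integral_compProd (show Integrable (fun s : Θ × (Fin m → Ξ) =>
    |gradEst h X x s.2 - ∫ ξ, pathGrad h X x ξ ∂(P s.1)|) (π ⊗ₘ iidKernel P m) from hint.abs)
  refine (le_of_eq h1).trans ?_
  refine (integral_mono houter (integrable_const (M * (√m)⁻¹)) hbd).trans (le_of_eq ?_)
  simp

theorem integrable_gradEst [IsMarkovKernel P] [IsProbabilityMeasure π] (hgrad : Measurable (pathGrad h X x)) {M : ℝ}
    (hM : ∀ θ, MemLp (pathGrad h X x) 2 (P θ) ∧ √(∫ ξ, pathGrad h X x ξ ^ 2 ∂(P θ)) ≤ M) (m : ℕ) :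
    Integrable (fun s => gradEst h X x s.2) (innerLaw π P m) := by
  rcases Nat.eq_zero_or_pos m with rfl | hm
  -- For m = 0 the empty sum makes the estimator identically zero.
  · simp [gradEst]
  · have hD : Integrable (fun θ => ∫ ξ, pathGrad h X x ξ ∂(P θ)) π :=
      Integrable.of_bound (measurable_integral_pathGrad hgrad).aestronglyMeasurable M
        (Eventually.of_forall fun θ => abs_integral_pathGrad_le hM θ)
    refine ((gradEst_deviation hgrad hM hm).1.add (integrable_innerLaw_fst hD m)).congr
      (Eventually.of_forall fun s => ?_)
    simp

/-! ### The bias -/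

theorem measurable_quantileEst (hα₀ : 0 < α) (hα₁ : α < 1) (hmeas : Measurable (h x)) {n : ℕ}
    (hn : 1 ≤ n) (m : ℕ) :
    Measurable fun s : Fin n → Θ × (Fin m → Ξ) => quantileEst h α x s := by
  have hn' : (1 : ℝ) ≤ n := by exact_mod_cast hn
  refine (measurable_orderStat (Nat.one_le_ceil_iff.2 (by positivity))
    (Nat.ceil_le.2 (by nlinarith))).comp (measurable_pi_lambda _ fun i => ?_)
  exact (measurable_meanEst hmeas m).comp (measurable_pi_apply i)

theorem integrable_above_mul_gradEst [IsMarkovKernel P] [IsProbabilityMeasure π] (hα₀ : 0 < α) (hα₁ : α < 1)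
    (hmeas : Measurable (h x)) (hgrad : Measurable (pathGrad h X x)) {M : ℝ}
    (hM : ∀ θ, MemLp (pathGrad h X x) 2 (P θ) ∧ √(∫ ξ, pathGrad h X x ξ ^ 2 ∂(P θ)) ≤ M)
    {n : ℕ} (m : ℕ) (i : Fin n) :
    Integrable (fun s => above (quantileEst h α x s) (meanEst h x (s i).2) * gradEst h X x (s i).2)
      (sampleLaw π P n m) := by
  have hG : Integrable (fun s : Fin n → Θ × (Fin m → Ξ) => gradEst h X x (s i).2)
      (sampleLaw π P n m) :=
    integrable_comp_eval (μ := fun _ : Fin n => innerLaw π P m) (i := i)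
      (integrable_gradEst hgrad hM m)
  refine hG.bdd_mul (c := 1) ?_ (Eventually.of_forall fun s => abs_above_le_one _ _)
  exact (measurable_above (measurable_quantileEst hα₀ hα₁ hmeas (by have := i.2; omega) m)
    ((measurable_meanEst hmeas m).comp (measurable_pi_apply i))).aestronglyMeasurable

theorem integrable_cvarGradEst [IsMarkovKernel P] [IsProbabilityMeasure π] (hα₀ : 0 < α) (hα₁ : α < 1)
    (hmeas : Measurable (h x)) (hgrad : Measurable (pathGrad h X x)) {M : ℝ}
    (hM : ∀ θ, MemLp (pathGrad h X x) 2 (P θ) ∧ √(∫ ξ, pathGrad h X x ξ ^ 2 ∂(P θ)) ≤ M)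
    (n m : ℕ) :
    Integrable (cvarGradEst h X α x) (sampleLaw π P n m) := by
  refine ((integrable_finsetSum Finset.univ fun i _ =>
    integrable_above_mul_gradEst hα₀ hα₁ hmeas hgrad hM m i).const_mul
      (1 / (n * (1 - α)))).congr (Eventually.of_forall fun s => ?_)
  exact (cvarGradEst_eq s).symm

end

/-- The bias is at most of order `1 / √m + 1 / √n`, uniformly in the sample sizes. -/
theorem exists_bound_cvarBias {Θ Ξ : Type*} [MeasurableSpace Θ] [MeasurableSpace Ξ]
    {π : Measure Θ} [IsProbabilityMeasure π] {P : Kernel Θ Ξ} [IsMarkovKernel P]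
    {h : ℝ → Ξ → ℝ} {X : Set ℝ} {α : ℝ} (hα₀ : 0 < α) (hα₁ : α < 1)
    {x : ℝ} (hx : x ∈ X) (hacc : AccPt x (𝓟 X)) (hmeas : ∀ y ∈ X, Measurable (h y))
    (hgrad : Measurable (pathGrad h X x)) (hdens : DensityAssumption π P h X)
    (hint : InterchangeAssumption π P h X) (hsup : SupremumAssumption P h X x)
    (hvar : VaRAssumption π P h X α) :
    ∃ A : ℝ, ∀ n m : ℕ, 1 ≤ n → 1 ≤ m →
      |cvarBias π P h X α x n m| ≤ A * ((√m)⁻¹ + (√n)⁻¹) := by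
  obtain ⟨M, hM₀, hM⟩ := exists_bound_pathGrad hgrad hsup
  set v := valueAtRisk π P h α x with hv
  obtain ⟨C, hC₀, hC⟩ := exists_bound_above_sub hx (hmeas x hx) hdens v
  set D : Θ → ℝ := fun θ => ∫ ξ, pathGrad h X x ξ ∂(P θ) with hD
  set H : Θ → ℝ := meanResponse P h x with hH
  have hDm : Measurable D := measurable_integral_pathGrad hgrad
  have hHm : Measurable H := measurable_meanResponse P (hmeas x hx)
  have hDb : ∀ θ, |D θ| ≤ M := abs_integral_pathGrad_le hM
  -- At an accumulation point the derivative within `X` is unique, so `derivWithin` equals the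
  -- computed value.
  have hderiv := (hasDerivWithinAt_condValueAtRisk hα₀ hα₁ hx hmeas hgrad hdens hint hsup
    hvar).derivWithin hacc.uniqueDiffWithinAt
  change _ = (1 - α)⁻¹ * ∫ θ, above v (H θ) * D θ ∂π at hderiv
  have ham : Measurable fun θ => above v (H θ) := measurable_above measurable_const hHm
  have haI : Integrable (fun θ => above v (H θ)) π :=
    Integrable.of_bound ham.aestronglyMeasurable 1
      (Eventually.of_forall fun θ => abs_above_le_one _ _)
  have haDI : Integrable (fun θ => above v (H θ) * D θ) π :=
    haI.mul_bdd (c := M) hDm.aestronglyMeasurable (Eventually.of_forall hDb)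
  have haint : ∫ θ, above v (H θ) ∂π = 1 - α :=
    integral_above_sInf hHm hα₀ hα₁ rfl (hvar.no_atom x hx)
  have hα : 0 < 1 - α := by linarith
  -- `M` pays for the gradient noise, `2 * C * M` for sample means on the wrong side of `v`, and the
  -- last `2 * M` for rounding and count fluctuation, as 1 + √n ≤ 2√n.
  refine ⟨(1 - α)⁻¹ * (M + M * (2 * C + 2)), fun n m hn hm => ?_⟩
  have hn' : (1 : ℝ) ≤ n := by exact_mod_cast hn
  have hn₀ : (0 : ℝ) < n := by linarith
  set μ := innerLaw π P m with hμ
  set S := sampleLaw π P n m with hS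
  -- transfer of integrals over one coordinate of the sample
  have hcoordI : ∀ (i : Fin n) {f : Θ × (Fin m → Ξ) → ℝ}, Integrable f μ →
      Integrable (fun s : Fin n → Θ × (Fin m → Ξ) => f (s i)) S := fun i f hf =>
    integrable_comp_eval (μ := fun _ : Fin n => μ) (i := i) hf
  have hcoord : ∀ (i : Fin n) {f : Θ × (Fin m → Ξ) → ℝ}, Integrable f μ →
      ∫ s : Fin n → Θ × (Fin m → Ξ), f (s i) ∂S = ∫ ω, f ω ∂μ := fun i f hf =>
    integral_comp_eval (μ := fun _ : Fin n => μ) (i := i) hf.1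
  have hφI := integrable_innerLaw_fst (P := P) haDI m
  have haI' := integrable_innerLaw_fst (P := P) haI m
  have hdev := gradEst_deviation (π := π) hgrad hM hm
  have hYm : Measurable fun s : Θ × (Fin m → Ξ) => meanEst h x s.2 :=
    measurable_meanEst (hmeas x hx) m
  have hdiffI : Integrable (fun s : Θ × (Fin m → Ξ) =>
      |above v (meanEst h x s.2) - above v (H s.1)|) μ :=
    ((Integrable.of_bound (measurable_above measurable_const hYm).aestronglyMeasurable 1
      (Eventually.of_forall fun θ => abs_above_le_one _ _)).sub haI').abs
  -- the bias as the integral of a single difference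
  set ψ : Fin n → (Fin n → Θ × (Fin m → Ξ)) → ℝ := fun i s =>
    above (quantileEst h α x s) (meanEst h x (s i).2) * gradEst h X x (s i).2 with hψ
  have hψI : ∀ i, Integrable (ψ i) S := fun i =>
    integrable_above_mul_gradEst hα₀ hα₁ (hmeas x hx) hgrad hM m i
  have hdI : ∀ i, Integrable (fun s => ψ i s - above v (H (s i).1) * D (s i).1) S := fun i =>
    (hψI i).sub (hcoordI i hφI)
  have hbias : cvarBias π P h X α x n m = (n * (1 - α))⁻¹ *
      ∫ s, ∑ i, (ψ i s - above v (H (s i).1) * D (s i).1) ∂S := by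
    have h1 : ∫ s, cvarGradEst h X α x s ∂S = (n * (1 - α))⁻¹ * ∑ i, ∫ s, ψ i s ∂S := by
      rw [← integral_finsetSum _ fun i _ => hψI i, ← integral_const_mul]
      refine integral_congr_ae (Eventually.of_forall fun s => ?_)
      simp only [cvarGradEst_eq, one_div, hψ]
    have h2 : ∀ i : Fin n, ∫ s : Fin n → Θ × (Fin m → Ξ), above v (H (s i).1) * D (s i).1 ∂S
        = ∫ θ, above v (H θ) * D θ ∂π := fun i => by
      rw [← integral_innerLaw_fst (P := P) (f := fun θ => above v (H θ) * D θ) (ham.mul hDm) m]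
      exact hcoord i hφI
    rw [cvarBias, hderiv, integral_finsetSum _ fun i _ => hdI i]
    simp_rw [integral_sub (hψI _) (hcoordI _ hφI), h2]
    rw [Finset.sum_sub_distrib, ← hS, h1]
    simp only [Finset.sum_const, Finset.card_univ, Fintype.card_fin, nsmul_eq_mul]
    field_simp
  -- the pointwise bound
  have hinj : ∀ᵐ s ∂S, Function.Injective fun i => meanEst h x (s i).2 :=
    ae_injective_of_no_atom hYm (measure_meanEst_eq hx (hmeas x hx) hdens hm) n
  set G : (Fin n → Θ × (Fin m → Ξ)) → ℝ := fun s =>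
    ∑ i, |gradEst h X x (s i).2 - D (s i).1| +
      M * (2 * ∑ i, |above v (meanEst h x (s i).2) - above v (H (s i).1)| + 1 +
        |∑ i, (above v (H (s i).1) - (1 - α))|) with hG
  have hpt : ∀ᵐ s ∂S, |∑ i, (ψ i s - above v (H (s i).1) * D (s i).1)| ≤ G s := by
    filter_upwards [hinj] with s hs
    refine (Finset.abs_sum_le_sum_abs _ _).trans ?_
    have h1 : ∀ i, |ψ i s - above v (H (s i).1) * D (s i).1| ≤
        |gradEst h X x (s i).2 - D (s i).1| +
          M * |above (quantileEst h α x s) (meanEst h x (s i).2) - above v (H (s i).1)| := by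
      intro i
      have e : ψ i s - above v (H (s i).1) * D (s i).1 =
          above (quantileEst h α x s) (meanEst h x (s i).2) *
              (gradEst h X x (s i).2 - D (s i).1) +
            D (s i).1 *
              (above (quantileEst h α x s) (meanEst h x (s i).2) - above v (H (s i).1)) := by
        simp only [hψ]; ring
      rw [e]
      refine (abs_add_le _ _).trans (add_le_add ?_ ?_)
      · rw [abs_mul]
        exact mul_le_of_le_one_left (abs_nonneg _) (abs_above_le_one _ _)
      · rw [abs_mul]
        exact mul_le_mul_of_nonneg_right (hDb _) (abs_nonneg _)
    refine (Finset.sum_le_sum fun i _ => h1 i).trans ?_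
    rw [Finset.sum_add_distrib, ← Finset.mul_sum]
    exact add_le_add_right (mul_le_mul_of_nonneg_left
      (sum_abs_above_orderStat_sub_le hn hs (fun i => H (s i).1) hα₀ hα₁ v) hM₀) _
  -- its expectation
  have hI1 : Integrable (fun s => ∑ i, |gradEst h X x (s i).2 - D (s i).1|) S :=
    integrable_finsetSum _ fun i _ => hcoordI i hdev.1.abs
  have hI2 : Integrable (fun s : Fin n → Θ × (Fin m → Ξ) =>
      ∑ i, |above v (meanEst h x (s i).2) - above v (H (s i).1)|) S :=
    integrable_finsetSum _ fun i _ => hcoordI i hdiffI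
  have hI3 : Integrable (fun s : Fin n → Θ × (Fin m → Ξ) =>
      |∑ i, (above v (H (s i).1) - (1 - α))|) S :=
    (integrable_finsetSum _ fun i _ => (hcoordI i haI').sub (integrable_const (1 - α))).abs
  have hE1 : ∫ s, ∑ i, |gradEst h X x (s i).2 - D (s i).1| ∂S ≤ n * (M * (√m)⁻¹) := by
    rw [integral_finsetSum _ fun i _ => hcoordI i hdev.1.abs]
    simp_rw [hcoord _ hdev.1.abs]
    simpa using mul_le_mul_of_nonneg_left hdev.2 hn₀.le
  have hE2 : ∫ s : Fin n → Θ × (Fin m → Ξ),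
      ∑ i, |above v (meanEst h x (s i).2) - above v (H (s i).1)| ∂S ≤ n * (C * (√m)⁻¹) := by
    rw [integral_finsetSum _ fun i _ => hcoordI i hdiffI]
    simp_rw [hcoord _ hdiffI]
    simpa using mul_le_mul_of_nonneg_left (hC m hm) hn₀.le
  have hE3 : ∫ s : Fin n → Θ × (Fin m → Ξ), |∑ i, (above v (H (s i).1) - (1 - α))| ∂S ≤ √n := by
    have hL : MemLp (fun s : Θ × (Fin m → Ξ) => above v (H s.1)) 2 μ :=
      MemLp.of_bound haI'.1 1 (Eventually.of_forall fun s => abs_above_le_one _ _)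
    -- The same moment bound now acts on the n outer samples; the indicator has second moment at
    -- most 1.
    have h1 := integral_abs_sum_sub_le hL n
    rw [hμ, integral_innerLaw_fst (P := P) ham m, haint] at h1
    refine h1.trans (mul_le_of_le_one_right (Real.sqrt_nonneg _) ?_)
    refine (Real.sqrt_le_sqrt ?_).trans_eq Real.sqrt_one
    refine (integral_mono_of_nonneg (Eventually.of_forall fun s => sq_nonneg _)
      (integrable_const (1 : ℝ)) (Eventually.of_forall fun s => ?_)).trans (by simp)
    exact (sq_le_one_iff_abs_le_one _).2 (abs_above_le_one _ _)
  have hI4 : Integrable (fun s : Fin n → Θ × (Fin m → Ξ) =>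
      2 * ∑ i, |above v (meanEst h x (s i).2) - above v (H (s i).1)| + 1) S :=
    (hI2.const_mul 2).add (integrable_const 1)
  have hI5 : Integrable (fun s : Fin n → Θ × (Fin m → Ξ) =>
      M * (2 * ∑ i, |above v (meanEst h x (s i).2) - above v (H (s i).1)| + 1 +
        |∑ i, (above v (H (s i).1) - (1 - α))|)) S := (hI4.add hI3).const_mul M
  have hGI : Integrable G S := hI1.add hI5
  have hGle : ∫ s, G s ∂S ≤ n * (M * (√m)⁻¹) + M * (2 * (n * (C * (√m)⁻¹)) + 1 + √n) := by
    have e : ∫ s, G s ∂S = ∫ s, ∑ i, |gradEst h X x (s i).2 - D (s i).1| ∂S +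
        M * (2 * ∫ s : Fin n → Θ × (Fin m → Ξ),
          ∑ i, |above v (meanEst h x (s i).2) - above v (H (s i).1)| ∂S + 1 +
          ∫ s : Fin n → Θ × (Fin m → Ξ), |∑ i, (above v (H (s i).1) - (1 - α))| ∂S) := by
      simp only [hG]
      rw [integral_add hI1 hI5, integral_const_mul, integral_add hI4 hI3,
        integral_add (hI2.const_mul 2) (integrable_const 1), integral_const_mul]
      simp
    rw [e]
    gcongr
  have habs : |∫ s, ∑ i, (ψ i s - above v (H (s i).1) * D (s i).1) ∂S| ≤
      n * (M * (√m)⁻¹) + M * (2 * (n * (C * (√m)⁻¹)) + 1 + √n) :=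
    (abs_integral_le_integral_abs.trans (integral_mono_ae
      (integrable_finsetSum _ fun i _ => hdI i).abs hGI hpt)).trans hGle
  have hsn : (1 : ℝ) ≤ √n := Real.one_le_sqrt.2 hn'
  have hsn₀ : 0 < √(n : ℝ) := by linarith
  have hsm₀ : 0 ≤ (√(m : ℝ))⁻¹ := inv_nonneg.2 (Real.sqrt_nonneg _)
  rw [hbias, abs_mul, abs_of_pos (inv_pos.2 (mul_pos hn₀ hα)), mul_inv, mul_comm (n : ℝ)⁻¹,
    mul_assoc, mul_assoc]
  refine mul_le_mul_of_nonneg_left ?_ (inv_nonneg.2 hα.le)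
  have hnn : (√n)⁻¹ * (n : ℝ) = √n := by
    rw [inv_mul_eq_div, Real.div_sqrt]
  rw [inv_mul_le_iff₀ hn₀]
  refine habs.trans ?_
  have e : (n : ℝ) * ((M + M * (2 * C + 2)) * ((√m)⁻¹ + (√n)⁻¹)) =
      (M + M * (2 * C + 2)) * (n * (√m)⁻¹) + (M + M * (2 * C + 2)) * ((√n)⁻¹ * n) := by ring
  rw [e, hnn]
  have hq : 0 ≤ (n : ℝ) * (√m)⁻¹ := by positivity
  nlinarith [mul_nonneg hM₀ hq, mul_nonneg hM₀ (sub_nonneg.2 hsn), mul_nonneg hM₀ hsn₀.le,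
    mul_nonneg (mul_nonneg hM₀ hC₀) hsn₀.le]

end NestedCVaR

/-! ### From the uniform bound to the limit and the rate -/

theorem mainTheorem3 {Θ Ξ : Type*} [MeasurableSpace Θ] [MeasurableSpace Ξ]
    (π : Measure Θ) [IsProbabilityMeasure π] (P : Kernel Θ Ξ) [IsMarkovKernel P]
    (h : ℝ → Ξ → ℝ) (X : Set ℝ) (α : ℝ) (hα₀ : 0 < α) (hα₁ : α < 1)
    (x : ℝ) (hx : x ∈ X) (hacc : AccPt x (𝓟 X))
    (hmeas : ∀ y ∈ X, Measurable (h y))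
    (hgrad : Measurable (NestedCVaR.pathGrad h X x))
    (hdens : NestedCVaR.DensityAssumption π P h X)
    (hint : NestedCVaR.InterchangeAssumption π P h X)
    (hsup : NestedCVaR.SupremumAssumption P h X x)
    (hvar : NestedCVaR.VaRAssumption π P h X α) :
    -- the quantities compared are well defined
    DifferentiableWithinAt ℝ (NestedCVaR.condValueAtRisk π P h α) X x ∧
    (∀ n m : ℕ, Integrable (NestedCVaR.cvarGradEst (Θ := Θ) h X α x)
      (NestedCVaR.sampleLaw π P n m)) ∧
    -- the bias tends to zero as both sample sizes tend to infinity
    Tendsto (fun q : ℕ × ℕ => NestedCVaR.cvarBias π P h X α x q.1 q.2)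
      (atTop ×ˢ atTop) (𝓝 0) ∧
    -- the rate along every budget sequence with sample sizes of the same order
    ∀ n m : ℕ → ℕ, Tendsto n atTop atTop → Tendsto m atTop atTop →
      (fun t => (n t : ℝ)) =Θ[atTop] (fun t => (m t : ℝ)) →
      (fun t => NestedCVaR.cvarBias π P h X α x (n t) (m t))
        =O[atTop] (fun t => (n t : ℝ) ^ (-(1 / 2) : ℝ)) := by

  have hmx := hmeas x hx
  obtain ⟨M, -, hM⟩ := NestedCVaR.exists_bound_pathGrad hgrad hsup
  obtain ⟨A, hA⟩ := NestedCVaR.exists_bound_cvarBias hα₀ hα₁ hx hacc hmeas hgrad hdens hint hsup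
    hvar
  have hinv : Tendsto (fun n : ℕ => (√(n : ℝ))⁻¹) atTop (𝓝 0) :=
    tendsto_inv_atTop_zero.comp (Real.tendsto_sqrt_atTop.comp tendsto_natCast_atTop_atTop)
  refine ⟨(NestedCVaR.hasDerivWithinAt_condValueAtRisk hα₀ hα₁ hx hmeas hgrad hdens hint hsup
      hvar).differentiableWithinAt,
    fun n m => NestedCVaR.integrable_cvarGradEst hα₀ hα₁ hmx hgrad hM n m, ?_, ?_⟩
  · have hlim : Tendsto (fun q : ℕ × ℕ => A * ((√(q.2 : ℝ))⁻¹ + (√(q.1 : ℝ))⁻¹))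
        (atTop ×ˢ atTop) (𝓝 0) := by
      simpa using ((hinv.comp tendsto_snd).add (hinv.comp tendsto_fst)).const_mul A
    refine squeeze_zero_norm' ?_ hlim
    filter_upwards [(eventually_ge_atTop 1).prod_mk (eventually_ge_atTop 1)] with q hq
    exact hA q.1 q.2 hq.1 hq.2
  · intro n m hn hm hnm
    obtain ⟨c, hc⟩ := hnm.1.bound
    -- From n ≤ c m follows 1/√m ≤ √c/√n, so the two rates add up to (√c + 1)/√n. The absolute value
    -- is needed since `A` carries no sign information.
    refine IsBigO.of_bound (|A| * (√c + 1)) ?_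
    filter_upwards [hc, hn.eventually_ge_atTop 1, hm.eventually_ge_atTop 1] with t ht hnt hmt
    have hn₀ : (0 : ℝ) < n t := by exact_mod_cast hnt
    have hm₀ : (0 : ℝ) < m t := by exact_mod_cast hmt
    simp only [Real.norm_natCast] at ht
    have hsqrt : (√(m t : ℝ))⁻¹ ≤ √c * (√(n t : ℝ))⁻¹ := by
      have h1 : √(n t : ℝ) ≤ √c * √(m t : ℝ) := by
        rw [← Real.sqrt_mul' _ hm₀.le]
        exact Real.sqrt_le_sqrt ht
      rw [← div_eq_mul_inv, le_div_iff₀ (Real.sqrt_pos.2 hn₀),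
        inv_mul_le_iff₀ (Real.sqrt_pos.2 hm₀), mul_comm]
      exact h1
    have hpow : ‖(n t : ℝ) ^ (-(1 / 2) : ℝ)‖ = (√(n t : ℝ))⁻¹ := by
      rw [Real.norm_of_nonneg (by positivity), Real.rpow_neg hn₀.le, Real.sqrt_eq_rpow]
    rw [hpow, Real.norm_eq_abs]
    refine (hA (n t) (m t) hnt hmt).trans ?_
    rw [mul_assoc]
    refine mul_le_mul (le_abs_self A) ?_ (by positivity) (abs_nonneg A)
    linarith
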